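/- Let $N\ge 1$, $s\in(0,1)$, $K_s(z)=|z|^{-N-2s}$ and $C(N,s)=\big(\int_{\mathbb R^N}\frac{1-\cos x_1}{|x|^{N+2s}}\,dx\big)^{-1}$. Let $\|v\|_s^2=\iint_{\mathbb R^{2N}}K_s(x-y)|v(x)-v(y)|^2\,dx\,dy$ be the Gagliardo seminorm, and let $H^s(\mathbb R^N)$ be the space of the $v\in L^2(\mathbb R^N)$ with $\|v\|_s<\infty$, with norm $(\|v\|_{L^2}^2+\|v\|_s^2)^{1/2}$. For an open set $\Omega\subseteq\mathbb R^N$ let $\mathcal X^s_0(\Omega)=\{v\in H^s(\mathbb R^N): v=0 \text{ a.e. in }\mathbb R^N\setminus\Omega\}$, with the same norm. For $f\in L^2(\mathbb R^N)$ let $\|f\|_{\mathcal X^s_0(\Omega)'}$ and $\|f\|_{H^{-s}(\mathbb R^N)}$ be the norms of the functional $v\mapsto\int fv$ in the dual spaces of $\mathcal X^s_0(\Omega)$ and of $H^s(\mathbb R^N)$. A weak solution of $$(-\Delta)^su=f \ \text{in } \Omega,\qquad u=0\ \text{in } \mathbb R^N\setminus\Omega$$ is a function $u\in\mathcal X^s_0(\Omega)$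 such that $$C(N,s)\iint_{\mathbb R^{2N}}K_s(x-y)(u(x)-u(y))(v(x)-v(y))\,dx\,dy=\int_{\mathbb R^N} fv\,dx\qquad\text{for every } v\in\mathcal X^s_0(\Omega).$$ Let $\Omega\subset\mathbb R^N$ be bounded and open, $f\in L^2(\mathbb R^N)$, and let $u$ be a weak solution of this problem. Let $h\in\mathbb R^N$ with $|h|<1$, and let $\phi:\mathbb R^N\to[0,1]$ be a Lipschitz function with $\operatorname{supp}\phi\subseteq B_1(0)$, the open unit ball. Put $u_h(x)=u(x+h)$ and $T_hu=\phi u_h+(1-\phi)u$, and assume that $\phi u_h\in\mathcal X^s_0(\Omega)$. (1) There is a constant $C$, depending only on $N$, $s$ and upper bounds for the Lipschitz constant $\operatorname{Lip}\phi$ and for $\operatorname{diam}\Omega$, such that $$\|T_hu-u\|_{L^2(\mathbb R^N)}^2\le\|u_h-u\|_{L^2(\mathbb R^N)}^2\le C|h|^{2s}\|f\|_{\mathcal X^s_0(\Omega)'}^2 .$$ (2) Let $\rho>0$ and $\theta\in(0,\pi/2)$. Assume in addition that $|h|\le\frac{\rho\sin\theta}{4}$ and that $\Omega$ satisfies the $(\rho,\theta)$-Lipschitz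 cone condition: for every $x_0\in\mathbb R^N$ there is a unit vector $\mathbf n$ such that, for every $\mathbf v$ with $0<|\mathbf v|<\rho$ and $\mathbf v\cdot\mathbf n>|\mathbf v|\cos\theta$, one has $y-\mathbf v\in\Omega$ for every $y\in B_{3\rho}(x_0)\cap\Omega$ and $y+\mathbf v\notin\Omega$ for every $y\in B_{3\rho}(x_0)\setminus\Omega$. Then $$\|T_hu-u\|_s^2\le\tilde C|h|^s\|f\|_{L^2(\mathbb R^N)}\|f\|_{H^{-s}(\mathbb R^N)},$$ where the constant $\tilde C$ depends only on $N$, $s$, $\rho$, $\theta$ and upper bounds for $\operatorname{Lip}\phi$ and for $\operatorname{diam}\Omega$. -/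

import Mathlib

open MeasureTheory
open scoped NNReal ENNReal

noncomputable section

/-- The singular kernel `K_s(z) = |z|^{-N-2s}`. -/
def fracKernel {N : ℕ} (s : ℝ) (z : EuclideanSpace ℝ (Fin N)) : ℝ :=
  ‖z‖ ^ (-((N : ℝ) + 2 * s))

/-- The normalization constant
`C(N, s) = (∫ (1 - cos x₁) / |x|^{N+2s} dx)⁻¹` of the fractional Laplacian. -/
def fracConst (N : ℕ) [NeZero N] (s : ℝ) : ℝ :=
  (∫ x : EuclideanSpace ℝ (Fin N), (1 - Real.cos (x 0)) * fracKernel s x)⁻¹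

/-- The square `‖v‖_s² = ∬ K_s(x - y) |v(x) - v(y)|² dx dy` of the Gagliardo seminorm, with
values in `[0, ∞]`. -/
def gagliardoSq {N : ℕ} (s : ℝ) (v : EuclideanSpace ℝ (Fin N) → ℝ) : ℝ≥0∞ :=
  ∫⁻ p : EuclideanSpace ℝ (Fin N) × EuclideanSpace ℝ (Fin N),
    ENNReal.ofReal (fracKernel s (p.1 - p.2) * |v p.1 - v p.2| ^ 2)

/-- Membership in the fractional Sobolev space `H^s(ℝ^N) = W^{s,2}(ℝ^N)`, for `0 < s < 1`. -/
def MemHs {N : ℕ} (s : ℝ) (v : EuclideanSpace ℝ (Fin N) → ℝ) : Prop :=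
  MemLp v 2 volume ∧ gagliardoSq s v < ∞

/-- The square of the norm of `H^s(ℝ^N)`: `‖v‖²_{L²} + ‖v‖_s²`. -/
def hsNormSq {N : ℕ} (s : ℝ) (v : EuclideanSpace ℝ (Fin N) → ℝ) : ℝ≥0∞ :=
  eLpNorm v 2 volume ^ 2 + gagliardoSq s v

/-- The space `X^s_0(Ω)` of the functions in `H^s(ℝ^N)` that vanish a.e. outside `Ω`, with the norm
of `H^s(ℝ^N)`. -/
def X0 {N : ℕ} (s : ℝ) (Ω : Set (EuclideanSpace ℝ (Fin N))) :
    Set (EuclideanSpace ℝ (Fin N) → ℝ) :=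
  {v | MemHs s v ∧ ∀ᵐ x ∂volume, x ∉ Ω → v x = 0}

/-- For `f ∈ L²(ℝ^N)`, the norm of `f` in the dual space `X^s_0(Ω)'`, that is, the operator norm of
the functional `v ↦ ∫ f v` on `X^s_0(Ω)`. -/
def dualNormX0 {N : ℕ} (s : ℝ) (Ω : Set (EuclideanSpace ℝ (Fin N)))
    (f : EuclideanSpace ℝ (Fin N) → ℝ) : ℝ≥0∞ :=
  ⨆ v ∈ {v | v ∈ X0 s Ω ∧ hsNormSq s v ≤ 1}, ENNReal.ofReal |∫ x, f x * v x|

/-- For `f ∈ L²(ℝ^N)`, the norm of `f` in `H^{-s}(ℝ^N)`, the dual space of `H^s(ℝ^N)`. -/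
def hMinusNorm {N : ℕ} (s : ℝ) (f : EuclideanSpace ℝ (Fin N) → ℝ) : ℝ≥0∞ :=
  ⨆ v ∈ {v | MemHs s v ∧ hsNormSq s v ≤ 1}, ENNReal.ofReal |∫ x, f x * v x|

/-- `u` is a weak solution of `(-Δ)^s u = f` in `Ω`, `u = 0` in `ℝ^N \ Ω`, for `f ∈ L²(ℝ^N)`. -/
def IsWeakSolution {N : ℕ} [NeZero N] (s : ℝ) (Ω : Set (EuclideanSpace ℝ (Fin N)))
    (f u : EuclideanSpace ℝ (Fin N) → ℝ) : Prop :=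
  u ∈ X0 s Ω ∧ ∀ v ∈ X0 s Ω,
    fracConst N s * ∫ p : EuclideanSpace ℝ (Fin N) × EuclideanSpace ℝ (Fin N),
      fracKernel s (p.1 - p.2) * (u p.1 - u p.2) * (v p.1 - v p.2) = ∫ x, f x * v x

/-- The translate `u_h(x) = u(x + h)`. -/
def translateBy {N : ℕ} (h : EuclideanSpace ℝ (Fin N)) (u : EuclideanSpace ℝ (Fin N) → ℝ) :
    EuclideanSpace ℝ (Fin N) → ℝ :=
  fun x => u (x + h)

/-- The localized translate `T_h u = φ u_h + (1 - φ) u`. -/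
def locTranslate {N : ℕ} (φ : EuclideanSpace ℝ (Fin N) → ℝ) (h : EuclideanSpace ℝ (Fin N))
    (u : EuclideanSpace ℝ (Fin N) → ℝ) : EuclideanSpace ℝ (Fin N) → ℝ :=
  fun x => φ x * translateBy h u x + (1 - φ x) * u x

/-- A cut-off function with Lipschitz constant (at most) `L`: `φ ∈ W^{1,∞}(ℝ^N)`, `0 ≤ φ ≤ 1`,
and the (closed) support of `φ` is contained in the open unit ball centered at `0`. -/
structure IsCutoff {N : ℕ} (L : ℝ≥0) (φ : EuclideanSpace ℝ (Fin N) → ℝ) : Prop where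
  lipschitz : LipschitzWith L φ
  nonneg : ∀ x, 0 ≤ φ x
  le_one : ∀ x, φ x ≤ 1
  support_subset : tsupport φ ⊆ Metric.ball 0 1

/-- The open cone `C_{ρ,θ}(n)`. -/
def openCone {N : ℕ} (ρ θ : ℝ) (n : EuclideanSpace ℝ (Fin N)) :
    Set (EuclideanSpace ℝ (Fin N)) :=
  {v | 0 < ‖v‖ ∧ ‖v‖ < ρ ∧ ‖v‖ * Real.cos θ < inner ℝ v n}

/-- The set `N_{ρ,θ}(x₀, Ω)` of admissible cone directions at `x₀`. -/
def coneDirections {N : ℕ} (ρ θ : ℝ) (x₀ : EuclideanSpace ℝ (Fin N))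
    (Ω : Set (EuclideanSpace ℝ (Fin N))) : Set (EuclideanSpace ℝ (Fin N)) :=
  {n | ‖n‖ = 1 ∧
    (∀ v ∈ openCone ρ θ n, ∀ y ∈ Metric.ball x₀ (3 * ρ) ∩ Ω, y - v ∈ Ω) ∧
    (∀ v ∈ openCone ρ θ n, ∀ y ∈ Metric.ball x₀ (3 * ρ) \ Ω, y + v ∉ Ω)}

/-- The (uniform) `(ρ, θ)`-Lipschitz cone condition. -/
def LipschitzConeCondition {N : ℕ} (ρ θ : ℝ) (Ω : Set (EuclideanSpace ℝ (Fin N))) : Prop :=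
  ∀ x₀, (coneDirections ρ θ x₀ Ω).Nonempty

end

/-! ### Integrability of the kernel and positivity of the normalization constant -/

section Kernel

variable {N : ℕ} {s : ℝ}

/-! Put `w = T_h u - u` and write `B` for the bilinear form of the Gagliardo energy.

For (1), `|w| ≤ |u_h - u|` because `0 ≤ φ ≤ 1`. A translation difference is controlled by the
energy, `‖u_h - u‖² ≤ C |h|^{2s} ‖u‖_s²` (`exists_eLpNorm_translateBy_sub_le`). Testing the equation
with `u` itself, together with the Poincaré inequality, bounds `‖u‖_s` by the dual norm of `f`
(`exists_gagliardoSq_le_dualNormX0`).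

For (2), expanding the energy of `T_h u = u + w` gives `‖w‖_s² = (‖T_h u‖_s² - ‖u‖_s²) - 2 B(u, w)`.
Since `w` is an admissible test function, `B(u, w)` is a multiple of `∫ f w`, which Cauchy–Schwarz
and (1) bound by `|h|^s ‖f‖_{L²} ‖f‖_{H^{-s}}`. It remains to see that localized translation raises
the energy by at most the factor `1 + C |h|^s` (`exists_gagliardoSq_locTranslate_le`). Without the
variation of `φ` this is convexity of the square plus translation invariance; the variation of `φ`
leaves a commutator of size `‖u_h - u‖²`, and Young's inequality with weight `|h|^s` balances the
two errors. -/

lemma fracKernel_nonneg (z : EuclideanSpace ℝ (Fin N)) : 0 ≤ fracKernel s z :=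
  Real.rpow_nonneg (norm_nonneg z) _

lemma measurable_fracKernel : Measurable (fracKernel (N := N) s) := by
  unfold fracKernel
  fun_prop

lemma one_le_rpow_mul_fracKernel (hs : 0 < s) {z : EuclideanSpace ℝ (Fin N)} {R : ℝ} (hz : z ≠ 0)
    (hR : ‖z‖ ≤ R) : 1 ≤ R ^ ((N : ℝ) + 2 * s) * fracKernel s z := by
  have hz' : 0 < ‖z‖ := norm_pos_iff.mpr hz
  have hp : 0 < ‖z‖ ^ ((N : ℝ) + 2 * s) := Real.rpow_pos_of_pos hz' _
  rw [fracKernel, Real.rpow_neg hz'.le, ← div_eq_mul_inv, one_le_div hp]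
  exact Real.rpow_le_rpow hz'.le hR (by positivity)

/-- The function `K_s(z) min(1, |z|²)` is integrable. -/
lemma integrable_fracKernel_mul_min [NeZero N] (hs0 : 0 < s) (hs1 : s < 1) :
    Integrable (fun z : EuclideanSpace ℝ (Fin N) => fracKernel s z * min 1 (‖z‖ ^ 2)) := by
  have hN : 1 ≤ N := Nat.one_le_iff_ne_zero.mpr (NeZero.ne N)
  have : Nontrivial (EuclideanSpace ℝ (Fin N)) :=
    Module.nontrivial_of_finrank_pos (R := ℝ) (by simpa using NeZero.pos N)
  have key := integrable_fun_norm_addHaar (E := EuclideanSpace ℝ (Fin N)) (F := ℝ) volume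
    (f := fun t => t ^ (-((N : ℝ) + 2 * s)) * min 1 (t ^ 2))
  refine key.mpr ?_
  rw [finrank_euclideanSpace_fin, ← Set.Ioc_union_Ioi_eq_Ioi (zero_le_one (α := ℝ))]
  have hpow : ∀ t : ℝ, 0 < t → ∀ a : ℝ,
      t ^ (N - 1) * (t ^ (-((N : ℝ) + 2 * s)) * t ^ a) = t ^ (-1 - 2 * s + a) := by
    intro t ht a
    rw [← Real.rpow_natCast t (N - 1), ← Real.rpow_add ht, ← Real.rpow_add ht]
    congr 1
    push_cast [Nat.cast_sub hN]
    ring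
  -- In polar coordinates the integrand is `t^{1-2s}` on `(0, 1]`, integrable as `s < 1`, and
  -- `t^{-1-2s}` beyond, integrable as `s > 0`.
  refine IntegrableOn.union ?_ ?_
  · have h1 : IntegrableOn (fun t : ℝ => t ^ (-1 - 2 * s + 2)) (Set.Ioc 0 1) :=
      (intervalIntegrable_iff_integrableOn_Ioc_of_le zero_le_one).mp
        (intervalIntegral.intervalIntegrable_rpow' (by linarith))
    refine h1.congr_fun (fun t ht => ?_) measurableSet_Ioc
    have : min 1 (t ^ 2) = t ^ (2 : ℝ) := by
      rw [min_eq_right (pow_le_one₀ ht.1.le ht.2)]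
      norm_cast
    simp only [smul_eq_mul]
    rw [this, hpow t ht.1]
  · have h1 : IntegrableOn (fun t : ℝ => t ^ (-1 - 2 * s + 0)) (Set.Ioi 1) :=
      integrableOn_Ioi_rpow_of_lt (by linarith) one_pos
    refine h1.congr_fun (fun t ht => ?_) measurableSet_Ioi
    have ht1 : (1 : ℝ) < t := ht
    have : min 1 (t ^ 2) = t ^ (0 : ℝ) := by
      rw [min_eq_left (one_le_pow₀ ht1.le), Real.rpow_zero]
    simp only [smul_eq_mul]
    rw [this, hpow t (by linarith)]

/-- Integrability is essential here: a divergent Bochner integral is `0` by convention, and so is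
its inverse. The integrand is dominated by `2 K_s(z) min(1, |z|²)`. -/
lemma fracConst_pos [NeZero N] (hs0 : 0 < s) (hs1 : s < 1) : 0 < fracConst N s := by
  have hnn : ∀ x : EuclideanSpace ℝ (Fin N), 0 ≤ 1 - Real.cos (x 0) := fun x =>
    sub_nonneg.mpr (Real.cos_le_one _)
  have hint : Integrable
      (fun x : EuclideanSpace ℝ (Fin N) => (1 - Real.cos (x 0)) * fracKernel s x) := by
    refine ((integrable_fracKernel_mul_min hs0 hs1).const_mul 2).mono' ?_ ?_
    · exact (Measurable.mul (by fun_prop) measurable_fracKernel).aestronglyMeasurable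
    · refine Filter.Eventually.of_forall fun x => ?_
      rw [Real.norm_of_nonneg (mul_nonneg (hnn x) (fracKernel_nonneg x))]
      have h0 : |x 0| ≤ ‖x‖ := by simpa using PiLp.norm_apply_le x 0
      have hsq : x 0 ^ 2 ≤ ‖x‖ ^ 2 := sq_le_sq.mpr (by rwa [abs_of_nonneg (norm_nonneg x)])
      have h1 : 1 - Real.cos (x 0) ≤ 2 * min 1 (‖x‖ ^ 2) := by
        rw [mul_min_of_nonneg _ _ (by norm_num)]
        refine le_min ?_ ?_
        · linarith [Real.neg_one_le_cos (x 0)]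
        · have := Real.one_sub_sq_div_two_le_cos (x := x 0)
          nlinarith [sq_nonneg (x 0)]
      calc (1 - Real.cos (x 0)) * fracKernel s x
          ≤ 2 * min 1 (‖x‖ ^ 2) * fracKernel s x := by
            gcongr
            exact fracKernel_nonneg x
        _ = 2 * (fracKernel s x * min 1 (‖x‖ ^ 2)) := by ring
  refine inv_pos.mpr ((integral_pos_iff_support_of_nonneg
    (fun x => mul_nonneg (hnn x) (fracKernel_nonneg x)) hint).mpr ?_)
  -- On this nonempty open slab `cos x₁ ≠ 1`, so the support has positive measure.
  have hopen : IsOpen {x : EuclideanSpace ℝ (Fin N) | 0 < x 0 ∧ x 0 < 2 * Real.pi} :=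
    (isOpen_lt continuous_const (PiLp.continuous_apply 2 _ 0)).and
      (isOpen_lt (PiLp.continuous_apply 2 _ 0) continuous_const)
  have hne : {x : EuclideanSpace ℝ (Fin N) | 0 < x 0 ∧ x 0 < 2 * Real.pi}.Nonempty :=
    ⟨EuclideanSpace.single 0 1, by simp, by simp; linarith [Real.pi_gt_three]⟩
  refine (hopen.measure_pos volume hne).trans_le (measure_mono fun x hx => ?_)
  refine mul_ne_zero (fun h => ?_) (Real.rpow_pos_of_pos (norm_pos_iff.mpr ?_) _).ne'
  · have hc : Real.cos (x 0) = 1 := by linarith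
    rw [Real.cos_eq_one_iff_of_lt_of_lt (by linarith [hx.1, Real.pi_pos]) hx.2] at hc
    exact hx.1.ne' hc
  · rintro rfl
    simp at hx

end Kernel

/-! ### Gagliardo energy and translation differences -/

section Gagliardo

variable {N : ℕ} {s : ℝ} {u v : EuclideanSpace ℝ (Fin N) → ℝ}

/-- The integrand of the Gagliardo seminorm. -/
noncomputable def gagliardoIntegrand (s : ℝ) (v : EuclideanSpace ℝ (Fin N) → ℝ)
    (p : EuclideanSpace ℝ (Fin N) × EuclideanSpace ℝ (Fin N)) : ℝ :=
  fracKernel s (p.1 - p.2) * |v p.1 - v p.2| ^ 2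

lemma gagliardoIntegrand_nonneg (p : EuclideanSpace ℝ (Fin N) × EuclideanSpace ℝ (Fin N)) :
    0 ≤ gagliardoIntegrand s v p :=
  mul_nonneg (fracKernel_nonneg _) (by positivity)

lemma aemeasurable_gagliardoIntegrand (hv : AEMeasurable v) :
    AEMeasurable (gagliardoIntegrand s v) := by
  have hK : Measurable fun p : EuclideanSpace ℝ (Fin N) × EuclideanSpace ℝ (Fin N) =>
      fracKernel s (p.1 - p.2) := measurable_fracKernel.comp (by fun_prop)
  have h1 : AEMeasurable fun p : EuclideanSpace ℝ (Fin N) × EuclideanSpace ℝ (Fin N) =>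
      v p.1 - v p.2 := (hv.comp_fst).sub (hv.comp_snd)
  exact hK.aemeasurable.mul ((measurable_norm.comp_aemeasurable h1).pow_const 2)

lemma aemeasurable_gagliardoIntegrand_left (hv : AEMeasurable v) (x : EuclideanSpace ℝ (Fin N)) :
    AEMeasurable fun y => gagliardoIntegrand s v (x, y) := by
  have hK : Measurable fun y : EuclideanSpace ℝ (Fin N) =>
      fracKernel s (x - y) := measurable_fracKernel.comp (by fun_prop)
  exact hK.aemeasurable.mul ((measurable_norm.comp_aemeasurable (hv.const_sub (v x))).pow_const 2)

lemma gagliardoSq_eq_lintegral_lintegral (hv : AEMeasurable v) :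
    gagliardoSq s v = ∫⁻ x, ∫⁻ y, ENNReal.ofReal (gagliardoIntegrand s v (x, y)) :=
  lintegral_prod _ (aemeasurable_gagliardoIntegrand hv).ennreal_ofReal

lemma sq_sub_le_rpow_mul_gagliardoIntegrand (hs : 0 < s) {x y : EuclideanSpace ℝ (Fin N)} {R : ℝ}
    (hR : ‖x - y‖ ≤ R) :
    (v x - v y) ^ 2 ≤ R ^ ((N : ℝ) + 2 * s) * gagliardoIntegrand s v (x, y) := by
  rcases eq_or_ne (x - y) 0 with h | h
  · rw [sub_eq_zero.mp h]
    simp [gagliardoIntegrand]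
  · rw [gagliardoIntegrand, ← mul_assoc, sq_abs]
    exact le_mul_of_one_le_left (sq_nonneg _) (one_le_rpow_mul_fracKernel hs h hR)

lemma eLpNorm_two_sq (g : EuclideanSpace ℝ (Fin N) → ℝ) :
    eLpNorm g 2 volume ^ 2 = ∫⁻ x, ENNReal.ofReal (g x ^ 2) := by
  have h := eLpNorm_nnreal_pow_eq_lintegral (f := g) (μ := volume) (p := 2) two_ne_zero
  simp only [NNReal.coe_ofNat, ENNReal.coe_ofNat] at h
  rw [← ENNReal.rpow_two, h]
  refine lintegral_congr fun x => ?_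
  rw [ENNReal.rpow_two, ← ofReal_norm, ← ENNReal.ofReal_pow (norm_nonneg _), Real.norm_eq_abs,
    sq_abs]

/-- The difference quotient estimate `‖u_h - u‖²_{L²} ≤ C |h|^{2s} ‖u‖_s²`. -/
lemma exists_eLpNorm_translateBy_sub_le (N : ℕ) [NeZero N] {s : ℝ} (hs : 0 < s) :
    ∃ C : ℝ, 0 < C ∧ ∀ (u : EuclideanSpace ℝ (Fin N) → ℝ) (h : EuclideanSpace ℝ (Fin N)),
      AEMeasurable u → eLpNorm (translateBy h u - u) 2 volume ^ 2 ≤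
        ENNReal.ofReal (C * ‖h‖ ^ (2 * s)) * gagliardoSq s u := by
  have : Nontrivial (EuclideanSpace ℝ (Fin N)) :=
    Module.nontrivial_of_finrank_pos (R := ℝ) (by simpa using NeZero.pos N)
  set b : ℝ := (volume (Metric.ball (0 : EuclideanSpace ℝ (Fin N)) 1)).toReal with hb
  have hball : volume (Metric.ball (0 : EuclideanSpace ℝ (Fin N)) 1) = ENNReal.ofReal b :=
    (ENNReal.ofReal_toReal measure_ball_lt_top.ne).symm
  have hb0 : 0 < b :=
    ENNReal.toReal_pos (Metric.measure_ball_pos volume 0 one_pos).ne' measure_ball_lt_top.ne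
  -- Averaging over a ball of radius `r = |h|` divides by `r^N b`; the kernel is at least
  -- `(2r)^{-(N+2s)}` there. One factor 2 comes from splitting the square, the other from two copies
  -- of the energy.
  refine ⟨4 * 2 ^ ((N : ℝ) + 2 * s) / b, by positivity, fun u h hu => ?_⟩
  rcases eq_or_ne h 0 with rfl | hh
  · simp [translateBy, Pi.sub_def]
  set r := ‖h‖ with hr
  have hr0 : 0 < r := norm_pos_iff.mpr hh
  set κ : ℝ := 2 * (2 * r) ^ ((N : ℝ) + 2 * s) with hκ
  have hκ0 : 0 ≤ κ := by positivity
  -- Compare `u (x + h)` and `u x` through every intermediate `y ∈ B_r(x)`, which lies within `2r`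
  -- of both points.
  have pointwise : ∀ x, ENNReal.ofReal (r ^ N * b) * ENNReal.ofReal ((u (x + h) - u x) ^ 2) ≤
      ENNReal.ofReal κ * ((∫⁻ y, ENNReal.ofReal (gagliardoIntegrand s u (x + h, y))) +
        ∫⁻ y, ENNReal.ofReal (gagliardoIntegrand s u (x, y))) := by
    intro x
    have hvol : volume (Metric.ball x r) = ENNReal.ofReal (r ^ N * b) := by
      rw [Measure.addHaar_ball _ _ hr0.le, hball, finrank_euclideanSpace_fin,
        ENNReal.ofReal_mul (by positivity)]
    rw [← hvol, mul_comm, ← setLIntegral_const,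
      ← lintegral_add_left' (aemeasurable_gagliardoIntegrand_left hu _).ennreal_ofReal,
      ← lintegral_const_mul' _ _ ENNReal.ofReal_ne_top]
    refine (setLIntegral_mono' measurableSet_ball fun y hy => ?_).trans (setLIntegral_le_lintegral _ _)
    rw [← ENNReal.ofReal_add (gagliardoIntegrand_nonneg _) (gagliardoIntegrand_nonneg _),
      ← ENNReal.ofReal_mul hκ0]
    refine ENNReal.ofReal_le_ofReal ?_
    have hy' : ‖x - y‖ ≤ r := by
      rw [← dist_eq_norm, dist_comm]
      exact (Metric.mem_ball.mp hy).le
    have h1 : ‖x + h - y‖ ≤ 2 * r := by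
      calc ‖x + h - y‖ = ‖(x - y) + h‖ := by congr 1; abel
        _ ≤ ‖x - y‖ + ‖h‖ := norm_add_le _ _
        _ ≤ 2 * r := by linarith
    have e1 := sq_sub_le_rpow_mul_gagliardoIntegrand (v := u) hs h1
    have e2 := sq_sub_le_rpow_mul_gagliardoIntegrand (v := u) hs
      (hy'.trans (by linarith : r ≤ 2 * r))
    have e3 : (u (x + h) - u x) ^ 2 ≤ 2 * (u (x + h) - u y) ^ 2 + 2 * (u x - u y) ^ 2 := by
      nlinarith [sq_nonneg ((u (x + h) - u y) + (u x - u y))]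
    rw [hκ]
    linarith
  have hG := gagliardoSq_eq_lintegral_lintegral (s := s) hu
  set Φ : EuclideanSpace ℝ (Fin N) → ℝ≥0∞ :=
    fun x => ∫⁻ y, ENNReal.ofReal (gagliardoIntegrand s u (x, y)) with hΦ
  have hΦm : AEMeasurable Φ :=
    (aemeasurable_gagliardoIntegrand hu).ennreal_ofReal.lintegral_prod_right'
  have main : ENNReal.ofReal (r ^ N * b) * eLpNorm (translateBy h u - u) 2 volume ^ 2 ≤
      ENNReal.ofReal (2 * κ) * gagliardoSq s u := by
    rw [eLpNorm_two_sq, ← lintegral_const_mul' _ _ ENNReal.ofReal_ne_top]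
    calc _ ≤ ∫⁻ x, ENNReal.ofReal κ * (Φ (x + h) + Φ x) := lintegral_mono pointwise
      _ = ENNReal.ofReal κ * ((∫⁻ x, Φ (x + h)) + ∫⁻ x, Φ x) := by
        rw [lintegral_const_mul' _ _ ENNReal.ofReal_ne_top, lintegral_add_right' _ hΦm]
      _ = ENNReal.ofReal (2 * κ) * gagliardoSq s u := by
        rw [lintegral_add_right_eq_self, hG, ENNReal.ofReal_mul (q := κ) zero_le_two, ← two_mul,
          ENNReal.ofReal_ofNat]
        ring
  have hrb : 0 < r ^ N * b := by positivity
  have hconst : 4 * 2 ^ ((N : ℝ) + 2 * s) / b * r ^ (2 * s) = (r ^ N * b)⁻¹ * (2 * κ) := by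
    rw [hκ, Real.mul_rpow zero_le_two hr0.le, Real.rpow_add hr0, Real.rpow_natCast]
    field_simp
    ring
  rw [hconst, ENNReal.ofReal_mul (by positivity), mul_assoc, ENNReal.ofReal_inv_of_pos hrb]
  rwa [mul_comm (ENNReal.ofReal (r ^ N * b))⁻¹, ← div_eq_mul_inv, ENNReal.le_div_iff_mul_le
    (Or.inl (ENNReal.ofReal_pos.mpr hrb).ne') (Or.inl ENNReal.ofReal_ne_top), mul_comm]

end Gagliardo

/-! ### Poincaré inequality, duality and the energy estimate -/

section Energy

variable {N : ℕ} {s : ℝ} {u v w f : EuclideanSpace ℝ (Fin N) → ℝ}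

/-- The fractional Poincaré inequality for functions vanishing a.e. outside a bounded set. -/
lemma exists_eLpNorm_sq_le_gagliardoSq (N : ℕ) [NeZero N] {s : ℝ} (hs : 0 < s) (d : ℝ) :
    ∃ C : ℝ, 0 < C ∧ ∀ (Ω : Set (EuclideanSpace ℝ (Fin N))) (u : EuclideanSpace ℝ (Fin N) → ℝ),
      Bornology.IsBounded Ω → Metric.diam Ω ≤ d → AEMeasurable u →
      (∀ᵐ x ∂volume, x ∉ Ω → u x = 0) →
      eLpNorm u 2 volume ^ 2 ≤ ENNReal.ofReal C * gagliardoSq s u := by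
  obtain ⟨C, hC, H⟩ := exists_eLpNorm_translateBy_sub_le N hs
  -- A shift longer than the diameter moves `Ω` off itself, so `|u| = |u_h - u|` a.e. on `Ω`.
  set h : EuclideanSpace ℝ (Fin N) := EuclideanSpace.single 0 (|d| + 1) with hh
  have hnorm : ‖h‖ = |d| + 1 := by
    rw [hh, EuclideanSpace.single, PiLp.norm_single, Real.norm_of_nonneg (by positivity)]
  refine ⟨C * ‖h‖ ^ (2 * s), by rw [hnorm]; positivity, fun Ω u hΩ hd hu h0 => ?_⟩
  refine le_trans ?_ (H u h hu)
  have h0' : ∀ᵐ x ∂volume, x + h ∉ Ω → u (x + h) = 0 :=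
    (measurePreserving_add_right volume h).quasiMeasurePreserving.ae h0
  rw [eLpNorm_two_sq, eLpNorm_two_sq]
  refine lintegral_mono_ae ?_
  filter_upwards [h0, h0'] with x hx hx'
  refine ENNReal.ofReal_le_ofReal ?_
  by_cases hxΩ : x ∈ Ω
  · have hxh : x + h ∉ Ω := fun hmem => by
      have := Metric.dist_le_diam_of_mem hΩ hmem hxΩ
      rw [dist_eq_norm, add_sub_cancel_left, hnorm] at this
      linarith [le_abs_self d]
    simp [translateBy, hx' hxh]
  · rw [hx hxΩ]
    simp only [ne_eq, OfNat.ofNat_ne_zero, not_false_eq_true, zero_pow]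
    positivity

lemma MemHs.aemeasurable (hv : MemHs s v) : AEMeasurable v := hv.1.1.aemeasurable

lemma MemHs.hsNormSq_ne_top (hv : MemHs s v) : hsNormSq s v ≠ ∞ :=
  ENNReal.add_ne_top.mpr ⟨ENNReal.pow_ne_top hv.1.2.ne, hv.2.ne⟩

lemma gagliardoSq_const_smul (t : ℝ) :
    gagliardoSq s (t • v) = ENNReal.ofReal (t ^ 2) * gagliardoSq s v := by
  unfold gagliardoSq
  rw [← lintegral_const_mul' _ _ ENNReal.ofReal_ne_top]
  refine lintegral_congr fun p => ?_
  rw [← ENNReal.ofReal_mul (sq_nonneg t)]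
  congr 1
  simp only [Pi.smul_apply, smul_eq_mul, ← mul_sub, abs_mul, mul_pow, sq_abs]
  ring

lemma hsNormSq_const_smul (t : ℝ) :
    hsNormSq s (t • v) = ENNReal.ofReal (t ^ 2) * hsNormSq s v := by
  unfold hsNormSq
  rw [gagliardoSq_const_smul, eLpNorm_const_smul, mul_pow, mul_add, ← ofReal_norm,
    ← ENNReal.ofReal_pow (norm_nonneg _), Real.norm_eq_abs, sq_abs]

lemma X0.const_smul {Ω : Set (EuclideanSpace ℝ (Fin N))} (hv : v ∈ X0 s Ω) (t : ℝ) :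
    t • v ∈ X0 s Ω := by
  refine ⟨⟨hv.1.1.const_smul t, ?_⟩, ?_⟩
  · rw [gagliardoSq_const_smul]
    exact ENNReal.mul_lt_top ENNReal.ofReal_lt_top hv.1.2
  · filter_upwards [hv.2] with x hx hxΩ
    simp [hx hxΩ]

/-- Rescale `v` to the unit sphere, where the supremum applies; a `v` of zero norm vanishes a.e. -/
lemma ofReal_abs_integral_mul_sq_le {Ω : Set (EuclideanSpace ℝ (Fin N))} (hv : v ∈ X0 s Ω) :
    ENNReal.ofReal |∫ x, f x * v x| ^ 2 ≤ dualNormX0 s Ω f ^ 2 * hsNormSq s v := by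
  rcases eq_or_ne (hsNormSq s v) 0 with h0 | h0
  · have hv0 : eLpNorm v 2 volume = 0 := by
      have := (add_eq_zero.mp h0).1
      simpa using this
    have hae := (eLpNorm_eq_zero_iff hv.1.1.1 two_ne_zero).mp hv0
    have : ∫ x, f x * v x = 0 := by
      refine integral_eq_zero_of_ae ?_
      filter_upwards [hae] with x hx
      simp [hx]
    simp [this]
  · set a := (hsNormSq s v).toReal with ha
    have haA : ENNReal.ofReal a = hsNormSq s v := ENNReal.ofReal_toReal hv.1.hsNormSq_ne_top
    have ha0 : 0 < a := ENNReal.toReal_pos h0 hv.1.hsNormSq_ne_top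
    have hsa : 0 < √a := Real.sqrt_pos.mpr ha0
    have hmem : (√a)⁻¹ • v ∈ {v | v ∈ X0 s Ω ∧ hsNormSq s v ≤ 1} := by
      refine ⟨X0.const_smul hv _, ?_⟩
      rw [hsNormSq_const_smul, ← haA, ← ENNReal.ofReal_mul (sq_nonneg _), inv_pow,
        Real.sq_sqrt ha0.le, inv_mul_cancel₀ ha0.ne', ENNReal.ofReal_one]
    have hle : ENNReal.ofReal |∫ x, f x * ((√a)⁻¹ • v) x| ≤ dualNormX0 s Ω f :=
      le_iSup₂ (f := fun (v : EuclideanSpace ℝ (Fin N) → ℝ)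
        (_ : v ∈ {v | v ∈ X0 s Ω ∧ hsNormSq s v ≤ 1}) => ENNReal.ofReal |∫ x, f x * v x|) _ hmem
    have hint : ∫ x, f x * v x = √a * ∫ x, f x * ((√a)⁻¹ • v) x := by
      rw [← integral_const_mul]
      refine integral_congr_ae (Filter.Eventually.of_forall fun x => ?_)
      simp only [Pi.smul_apply, smul_eq_mul]
      field_simp
    rw [hint, abs_mul, abs_of_pos hsa, ENNReal.ofReal_mul hsa.le, mul_pow, ← haA,
      ← ENNReal.ofReal_pow hsa.le, Real.sq_sqrt ha0.le, mul_comm]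
    gcongr

lemma ofReal_abs_integral_mul_le (hf : MemLp f 2 volume) (hv : MemLp v 2 volume) :
    ENNReal.ofReal |∫ x, f x * v x| ≤ eLpNorm f 2 volume * eLpNorm v 2 volume := by
  have h := eLpNorm_smul_le_mul_eLpNorm (p := 2) (q := 2) (r := 1) hv.1 hf.1
  refine le_trans ?_ h
  rw [eLpNorm_one_eq_lintegral_enorm, ← Real.norm_eq_abs, ofReal_norm]
  exact enorm_integral_le_lintegral_enorm _

lemma dualNormX0_le_hMinusNorm (Ω : Set (EuclideanSpace ℝ (Fin N))) :
    dualNormX0 s Ω f ≤ hMinusNorm s f :=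
  biSup_mono fun _ hv => ⟨hv.1.1, hv.2⟩

lemma hMinusNorm_le_eLpNorm (hf : MemLp f 2 volume) : hMinusNorm s f ≤ eLpNorm f 2 volume := by
  refine iSup₂_le fun v hv => (ofReal_abs_integral_mul_le hf hv.1.1).trans ?_
  have h1 : eLpNorm v 2 volume ^ 2 ≤ 1 := le_self_add.trans hv.2
  exact mul_le_of_le_one_right' ((pow_le_one_iff two_ne_zero).mp h1)

lemma MemHs.integrable_gagliardoIntegrand (hv : MemHs s v) :
    Integrable (gagliardoIntegrand s v) := by
  refine ⟨(aemeasurable_gagliardoIntegrand hv.aemeasurable).aestronglyMeasurable, ?_⟩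
  rw [hasFiniteIntegral_iff_ofReal (Filter.Eventually.of_forall gagliardoIntegrand_nonneg)]
  exact hv.2

lemma MemHs.ofReal_integral_gagliardoIntegrand (hv : MemHs s v) :
    ENNReal.ofReal (∫ p, gagliardoIntegrand s v p) = gagliardoSq s v :=
  ofReal_integral_eq_lintegral_ofReal hv.integrable_gagliardoIntegrand
    (Filter.Eventually.of_forall gagliardoIntegrand_nonneg)

lemma integral_gagliardoIntegrand_nonneg : 0 ≤ ∫ p, gagliardoIntegrand s v p :=
  integral_nonneg gagliardoIntegrand_nonneg

/-- The energy estimate `‖u‖_s ≤ C ‖f‖_{X^s_0(Ω)'}`. -/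
lemma exists_gagliardoSq_le_dualNormX0 (N : ℕ) [NeZero N] {s : ℝ} (hs0 : 0 < s) (hs1 : s < 1)
    (d : ℝ) : ∃ C : ℝ, 0 < C ∧ ∀ (Ω : Set (EuclideanSpace ℝ (Fin N)))
      (f u : EuclideanSpace ℝ (Fin N) → ℝ), Bornology.IsBounded Ω → Metric.diam Ω ≤ d →
      IsWeakSolution s Ω f u →
      gagliardoSq s u ≤ ENNReal.ofReal C * dualNormX0 s Ω f ^ 2 := by
  obtain ⟨P, hP, H⟩ := exists_eLpNorm_sq_le_gagliardoSq N hs0 d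
  have hc : 0 < fracConst N s := fracConst_pos hs0 hs1
  set c := fracConst N s
  -- With `g = ‖u‖_s²`, testing with `u` gives `(c g)² ≤ ‖f‖_{X'}² (P + 1) g`; then cancel one `g`.
  refine ⟨(P + 1) / c ^ 2, by positivity, fun Ω f u hΩ hd hu => ?_⟩
  have hHs := hu.1.1
  set g := ∫ p, gagliardoIntegrand s u p with hg
  have hgG : ENNReal.ofReal g = gagliardoSq s u := hHs.ofReal_integral_gagliardoIntegrand
  have hg0 : 0 ≤ g := integral_gagliardoIntegrand_nonneg
  have htest : c * g = ∫ x, f x * u x := by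
    rw [← hu.2 u hu.1, hg]
    congr 2
    ext p
    rw [gagliardoIntegrand, sq_abs]
    ring
  have h1 := ofReal_abs_integral_mul_sq_le (f := f) hu.1
  have h2 : hsNormSq s u ≤ ENNReal.ofReal (P + 1) * ENNReal.ofReal g := by
    rw [hsNormSq, ENNReal.ofReal_add hP.le zero_le_one, add_mul, ENNReal.ofReal_one, one_mul, hgG]
    gcongr
    exact H Ω u hΩ hd hHs.aemeasurable hu.1.2
  rw [← htest, abs_of_nonneg (by positivity)] at h1
  rcases hg0.eq_or_lt with h | hgpos
  · rw [← hgG, ← h]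
    simp
  have hgne : ENNReal.ofReal g ≠ 0 := (ENNReal.ofReal_pos.mpr hgpos).ne'
  have h3 : ENNReal.ofReal g * ENNReal.ofReal (c ^ 2 * g) ≤
      ENNReal.ofReal g * (ENNReal.ofReal (P + 1) * dualNormX0 s Ω f ^ 2) := by
    calc _ = ENNReal.ofReal (c * g) ^ 2 := by
          rw [← ENNReal.ofReal_mul hg0, ← ENNReal.ofReal_pow (by positivity)]
          congr 1
          ring
      _ ≤ dualNormX0 s Ω f ^ 2 * (ENNReal.ofReal (P + 1) * ENNReal.ofReal g) := by
          refine h1.trans ?_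
          gcongr
      _ = _ := by ring
  have h4 := (ENNReal.mul_le_mul_iff_right hgne ENNReal.ofReal_ne_top).mp h3
  rw [← hgG, div_eq_inv_mul, ENNReal.ofReal_mul (by positivity), mul_assoc]
  calc ENNReal.ofReal g = ENNReal.ofReal (c ^ 2)⁻¹ * ENNReal.ofReal (c ^ 2 * g) := by
        rw [← ENNReal.ofReal_mul (by positivity)]
        congr 1
        field_simp
    _ ≤ _ := by gcongr

lemma MemHs.integrable_fracKernel_mul (hu : MemHs s u) (hw : MemHs s w) :
    Integrable fun p : EuclideanSpace ℝ (Fin N) × EuclideanSpace ℝ (Fin N) =>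
      fracKernel s (p.1 - p.2) * (u p.1 - u p.2) * (w p.1 - w p.2) := by
  refine (hu.integrable_gagliardoIntegrand.add hw.integrable_gagliardoIntegrand).mono' ?_ ?_
  · have hK : Measurable fun p : EuclideanSpace ℝ (Fin N) × EuclideanSpace ℝ (Fin N) =>
      fracKernel s (p.1 - p.2) := measurable_fracKernel.comp (by fun_prop)
    exact ((hK.aemeasurable.mul (hu.aemeasurable.comp_fst.sub hu.aemeasurable.comp_snd)).mul
      (hw.aemeasurable.comp_fst.sub hw.aemeasurable.comp_snd)).aestronglyMeasurable
  · refine Filter.Eventually.of_forall fun p => ?_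
    simp only [gagliardoIntegrand, Pi.add_apply]
    rw [← mul_add, mul_assoc, norm_mul, Real.norm_of_nonneg (fracKernel_nonneg _), norm_mul,
      Real.norm_eq_abs, Real.norm_eq_abs]
    refine mul_le_mul_of_nonneg_left ?_ (fracKernel_nonneg _)
    nlinarith [sq_nonneg (|u p.1 - u p.2| - |w p.1 - w p.2|), sq_nonneg |u p.1 - u p.2|,
      sq_nonneg |w p.1 - w p.2|]

/-- The cross term is exactly the form in the weak equation, so it can be traded for `∫ f w`. -/
lemma MemHs.integral_gagliardoIntegrand_add (hu : MemHs s u) (hw : MemHs s w) :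
    ∫ p, gagliardoIntegrand s (u + w) p = (∫ p, gagliardoIntegrand s u p) +
      2 * (∫ p : EuclideanSpace ℝ (Fin N) × EuclideanSpace ℝ (Fin N),
        fracKernel s (p.1 - p.2) * (u p.1 - u p.2) * (w p.1 - w p.2)) +
      ∫ p, gagliardoIntegrand s w p := by
  have hB := (hu.integrable_fracKernel_mul hw).const_mul 2
  rw [← integral_const_mul, ← integral_add hu.integrable_gagliardoIntegrand hB, ← integral_add
    (by exact hu.integrable_gagliardoIntegrand.add hB) hw.integrable_gagliardoIntegrand]
  congr 1
  ext p
  simp only [gagliardoIntegrand, Pi.add_apply, sq_abs]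
  ring

lemma gagliardoSq_sub_le (hu : AEMeasurable u) :
    gagliardoSq s (v - u) ≤ 2 * gagliardoSq s v + 2 * gagliardoSq s u := by
  have hm := (aemeasurable_gagliardoIntegrand (s := s) hu).ennreal_ofReal.const_mul 2
  change ∫⁻ p, ENNReal.ofReal (gagliardoIntegrand s (v - u) p) ≤
    2 * (∫⁻ p, ENNReal.ofReal (gagliardoIntegrand s v p)) +
      2 * ∫⁻ p, ENNReal.ofReal (gagliardoIntegrand s u p)
  rw [← lintegral_const_mul' _ _ ENNReal.ofNat_ne_top,
    ← lintegral_const_mul' _ _ ENNReal.ofNat_ne_top, ← lintegral_add_right' _ hm]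
  refine lintegral_mono fun p => ?_
  rw [← ENNReal.ofReal_ofNat 2, ← ENNReal.ofReal_mul zero_le_two, ← ENNReal.ofReal_mul zero_le_two,
    ← ENNReal.ofReal_add (mul_nonneg zero_le_two (gagliardoIntegrand_nonneg _))
      (mul_nonneg zero_le_two (gagliardoIntegrand_nonneg _))]
  refine ENNReal.ofReal_le_ofReal ?_
  simp only [gagliardoIntegrand, Pi.sub_apply, sq_abs]
  have := mul_nonneg (fracKernel_nonneg (s := s) (p.1 - p.2))
    (sq_nonneg ((v p.1 - v p.2) + (u p.1 - u p.2)))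
  linarith

lemma MemHs.sub (hv : MemHs s v) (hu : MemHs s u) : MemHs s (v - u) :=
  ⟨hv.1.sub hu.1, (gagliardoSq_sub_le hu.aemeasurable).trans_lt (ENNReal.add_lt_top.mpr
    ⟨ENNReal.mul_lt_top ENNReal.ofNat_lt_top hv.2, ENNReal.mul_lt_top ENNReal.ofNat_lt_top hu.2⟩)⟩

end Energy

/-! ### Energy of the localized translate -/

section LocTranslate

variable {N : ℕ} {s : ℝ} {L : ℝ≥0} {u φ : EuclideanSpace ℝ (Fin N) → ℝ}
  {h : EuclideanSpace ℝ (Fin N)}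

/-- The Lipschitz bound tames the singularity of the kernel on the diagonal; the bound `1` preserves
its decay at infinity. -/
lemma IsCutoff.sub_sq_le (hφ : IsCutoff L φ) (x y : EuclideanSpace ℝ (Fin N)) :
    (φ x - φ y) ^ 2 ≤ (1 + (L : ℝ) ^ 2) * min 1 (‖x - y‖ ^ 2) := by
  rw [mul_min_of_nonneg _ _ (by positivity)]
  have h1 : |φ x - φ y| ≤ 1 :=
    abs_sub_le_iff.mpr ⟨by linarith [hφ.le_one x, hφ.nonneg y],
      by linarith [hφ.le_one y, hφ.nonneg x]⟩
  have h2 : |φ x - φ y| ≤ L * ‖x - y‖ := by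
    simpa [dist_eq_norm] using hφ.lipschitz.dist_le_mul x y
  rw [← sq_abs]
  refine le_min ?_ ?_
  · have := pow_le_one₀ (n := 2) (abs_nonneg _) h1
    nlinarith [sq_nonneg (L : ℝ)]
  · have := pow_le_pow_left₀ (abs_nonneg _) h2 2
    nlinarith [sq_nonneg ‖x - y‖]

/-- For fixed `y`, the integral in `x` is bounded by a constant independent of `y`, by translation
invariance. -/
lemma lintegral_commutator_le [NeZero N] (hs0 : 0 < s) (hs1 : s < 1) (hφ : IsCutoff L φ)
    {g : EuclideanSpace ℝ (Fin N) → ℝ} (hg : AEMeasurable g) :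
    ∫⁻ p : EuclideanSpace ℝ (Fin N) × EuclideanSpace ℝ (Fin N),
      ENNReal.ofReal (fracKernel s (p.1 - p.2) * (φ p.1 - φ p.2) ^ 2 * g p.2 ^ 2) ≤
    ENNReal.ofReal ((1 + (L : ℝ) ^ 2) *
      ∫ z : EuclideanSpace ℝ (Fin N), fracKernel s z * min 1 (‖z‖ ^ 2)) *
      eLpNorm g 2 volume ^ 2 := by
  have hK : Measurable fun p : EuclideanSpace ℝ (Fin N) × EuclideanSpace ℝ (Fin N) =>
      fracKernel s (p.1 - p.2) := measurable_fracKernel.comp (by fun_prop)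
  have hφm : Measurable φ := hφ.lipschitz.continuous.measurable
  have hφ2 : Measurable fun p : EuclideanSpace ℝ (Fin N) × EuclideanSpace ℝ (Fin N) =>
      (φ p.1 - φ p.2) ^ 2 := by fun_prop
  have hm : AEMeasurable fun p : EuclideanSpace ℝ (Fin N) × EuclideanSpace ℝ (Fin N) =>
      fracKernel s (p.1 - p.2) * (φ p.1 - φ p.2) ^ 2 * g p.2 ^ 2 :=
    ((hK.mul hφ2).aemeasurable).mul (hg.comp_snd.pow_const 2)
  have hnn : ∀ z : EuclideanSpace ℝ (Fin N), 0 ≤ fracKernel s z * min 1 (‖z‖ ^ 2) := fun z =>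
    mul_nonneg (fracKernel_nonneg z) (by positivity)
  rw [Measure.volume_eq_prod, lintegral_prod_symm _ hm.ennreal_ofReal, eLpNorm_two_sq,
    ← lintegral_const_mul' _ _ ENNReal.ofReal_ne_top]
  refine lintegral_mono fun y => ?_
  have hL : (0 : ℝ) ≤ 1 + (L : ℝ) ^ 2 := by positivity
  calc ∫⁻ x, ENNReal.ofReal (fracKernel s (x - y) * (φ x - φ y) ^ 2 * g y ^ 2)
      ≤ ∫⁻ x, ENNReal.ofReal ((1 + (L : ℝ) ^ 2) * g y ^ 2) *
          ENNReal.ofReal (fracKernel s (x - y) * min 1 (‖x - y‖ ^ 2)) := by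
        refine lintegral_mono fun x => ?_
        rw [← ENNReal.ofReal_mul (by positivity)]
        refine ENNReal.ofReal_le_ofReal ?_
        have := mul_le_mul_of_nonneg_left (hφ.sub_sq_le x y)
          (mul_nonneg (fracKernel_nonneg (s := s) (x - y)) (sq_nonneg (g y)))
        linarith
    _ = ENNReal.ofReal ((1 + (L : ℝ) ^ 2) * g y ^ 2) * ENNReal.ofReal
          (∫ z : EuclideanSpace ℝ (Fin N), fracKernel s z * min 1 (‖z‖ ^ 2)) := by
        rw [lintegral_const_mul' _ _ ENNReal.ofReal_ne_top,
          lintegral_sub_right_eq_self (fun z : EuclideanSpace ℝ (Fin N) =>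
            ENNReal.ofReal (fracKernel s z * min 1 (‖z‖ ^ 2))) y,
          ofReal_integral_eq_lintegral_ofReal (integrable_fracKernel_mul_min hs0 hs1)
            (Filter.Eventually.of_forall hnn)]
    _ = _ := by
        rw [← ENNReal.ofReal_mul (by positivity),
          ← ENNReal.ofReal_mul (mul_nonneg hL (integral_nonneg hnn))]
        congr 1
        ring

/-- Translating the localized energy of `u_h` back costs the increment of the cut-off. -/
lemma lintegral_convex_combination_le (hφ : IsCutoff L φ) (hu : AEMeasurable u) :
    (∫⁻ p : EuclideanSpace ℝ (Fin N) × EuclideanSpace ℝ (Fin N),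
      ENNReal.ofReal (φ p.1 * gagliardoIntegrand s (translateBy h u) p +
        (1 - φ p.1) * gagliardoIntegrand s u p)) ≤
      ENNReal.ofReal (1 + L * ‖h‖) * gagliardoSq s u := by
  have hφm : Measurable φ := hφ.lipschitz.continuous.measurable
  have h1φ : ∀ x, 0 ≤ 1 - φ x := fun x => sub_nonneg.mpr (hφ.le_one x)
  have hm2 : AEMeasurable fun p : EuclideanSpace ℝ (Fin N) × EuclideanSpace ℝ (Fin N) =>
      ENNReal.ofReal ((1 - φ p.1) * gagliardoIntegrand s u p) :=
    (AEMeasurable.mul (by fun_prop) (aemeasurable_gagliardoIntegrand hu)).ennreal_ofReal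
  -- Shifting both variables by `h` leaves `x - y` unchanged and moves the translation from `u` onto
  -- `φ`.
  have hshift : (∫⁻ p : EuclideanSpace ℝ (Fin N) × EuclideanSpace ℝ (Fin N),
      ENNReal.ofReal (φ p.1 * gagliardoIntegrand s (translateBy h u) p)) =
      ∫⁻ p : EuclideanSpace ℝ (Fin N) × EuclideanSpace ℝ (Fin N),
        ENNReal.ofReal (φ (p.1 - h) * gagliardoIntegrand s u p) := by
    rw [Measure.volume_eq_prod, ← lintegral_add_right_eq_self
      (μ := (volume : Measure (EuclideanSpace ℝ (Fin N))).prod volume)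
      (fun p => ENNReal.ofReal (φ (p.1 - h) * gagliardoIntegrand s u p)) (h, h)]
    refine lintegral_congr fun p => ?_
    simp [gagliardoIntegrand, translateBy]
  calc _ = ∫⁻ p : EuclideanSpace ℝ (Fin N) × EuclideanSpace ℝ (Fin N),
        (ENNReal.ofReal (φ p.1 * gagliardoIntegrand s (translateBy h u) p) +
        ENNReal.ofReal ((1 - φ p.1) * gagliardoIntegrand s u p)) := by
        refine lintegral_congr fun p => ?_
        rw [ENNReal.ofReal_add (mul_nonneg (hφ.nonneg _) (gagliardoIntegrand_nonneg _))
          (mul_nonneg (h1φ _) (gagliardoIntegrand_nonneg _))]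
    _ = ∫⁻ p : EuclideanSpace ℝ (Fin N) × EuclideanSpace ℝ (Fin N),
        (ENNReal.ofReal (φ (p.1 - h) * gagliardoIntegrand s u p) +
        ENNReal.ofReal ((1 - φ p.1) * gagliardoIntegrand s u p)) := by
        rw [lintegral_add_right' _ hm2, lintegral_add_right' _ hm2, hshift]
    _ ≤ ∫⁻ p, ENNReal.ofReal (1 + L * ‖h‖) * ENNReal.ofReal (gagliardoIntegrand s u p) := by
        refine lintegral_mono fun p => ?_
        rw [← ENNReal.ofReal_add (mul_nonneg (hφ.nonneg _) (gagliardoIntegrand_nonneg _))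
          (mul_nonneg (h1φ _) (gagliardoIntegrand_nonneg _)), ← ENNReal.ofReal_mul (by positivity),
          ← add_mul]
        refine ENNReal.ofReal_le_ofReal
          (mul_le_mul_of_nonneg_right ?_ (gagliardoIntegrand_nonneg _))
        have := hφ.lipschitz.dist_le_mul (p.1 - h) p.1
        rw [Real.dist_eq, dist_eq_norm, sub_sub_cancel_left, norm_neg] at this
        linarith [le_abs_self (φ (p.1 - h) - φ p.1)]
    _ = _ := lintegral_const_mul' _ _ ENNReal.ofReal_ne_top

/-- The increment of `T_h u` is a convex combination of the increments of `u_h` and `u`, plus `(φ x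
- φ y)(u_h - u)(y)`. Young's inequality separates the two, and convexity of the square handles the
first. -/
lemma gagliardoIntegrand_locTranslate_le (hφ : IsCutoff L φ) {ε : ℝ} (hε : 0 < ε)
    (p : EuclideanSpace ℝ (Fin N) × EuclideanSpace ℝ (Fin N)) :
    gagliardoIntegrand s (locTranslate φ h u) p ≤
      (1 + ε) * (φ p.1 * gagliardoIntegrand s (translateBy h u) p +
        (1 - φ p.1) * gagliardoIntegrand s u p) +
      (1 + ε⁻¹) * (fracKernel s (p.1 - p.2) * (φ p.1 - φ p.2) ^ 2 *
        (translateBy h u - u) p.2 ^ 2) := by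
  simp only [gagliardoIntegrand, locTranslate, sq_abs, Pi.sub_apply]
  have h0 := hφ.nonneg p.1
  have h1 := hφ.le_one p.1
  generalize φ p.1 = t at *
  generalize φ p.2 = t'
  generalize translateBy h u p.1 = a
  generalize translateBy h u p.2 = a'
  generalize u p.1 = b
  generalize u p.2 = b'
  have key : (t * a + (1 - t) * b - (t' * a' + (1 - t') * b')) ^ 2 ≤
      (1 + ε) * (t * (a - a') ^ 2 + (1 - t) * (b - b') ^ 2) +
        (1 + ε⁻¹) * ((t - t') ^ 2 * (a' - b') ^ 2) := by
    have hconv : (t * (a - a') + (1 - t) * (b - b')) ^ 2 ≤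
        t * (a - a') ^ 2 + (1 - t) * (b - b') ^ 2 := by
      have := mul_nonneg (mul_nonneg h0 (sub_nonneg.mpr h1)) (sq_nonneg ((a - a') - (b - b')))
      linarith
    have hyoung : ∀ X Y : ℝ, (X + Y) ^ 2 ≤ (1 + ε) * X ^ 2 + (1 + ε⁻¹) * Y ^ 2 := by
      intro X Y
      have h2 : (1 + ε) * X ^ 2 + (1 + ε⁻¹) * Y ^ 2 - (X + Y) ^ 2 = ε⁻¹ * (ε * X - Y) ^ 2 := by
        field_simp
        ring
      have := mul_nonneg (inv_pos.mpr hε).le (sq_nonneg (ε * X - Y))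
      linarith
    have h3 := hyoung (t * (a - a') + (1 - t) * (b - b')) ((t - t') * (a' - b'))
    have h4 := mul_le_mul_of_nonneg_left hconv (by positivity : 0 ≤ 1 + ε)
    calc _ = (t * (a - a') + (1 - t) * (b - b') + (t - t') * (a' - b')) ^ 2 := by ring
      _ ≤ _ := by
        rw [mul_pow] at h3
        linarith
  have := mul_le_mul_of_nonneg_left key (fracKernel_nonneg (s := s) (p.1 - p.2))
  linarith

/-- The energy of the localized translate: `‖T_h u‖_s² ≤ (1 + C |h|^s) ‖u‖_s²`. -/
lemma exists_gagliardoSq_locTranslate_le (N : ℕ) [NeZero N] {s : ℝ} (hs0 : 0 < s) (hs1 : s < 1)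
    (L : ℝ≥0) : ∃ C : ℝ, 0 < C ∧ ∀ (φ u : EuclideanSpace ℝ (Fin N) → ℝ)
      (h : EuclideanSpace ℝ (Fin N)), IsCutoff L φ → AEMeasurable u → h ≠ 0 → ‖h‖ < 1 →
      gagliardoSq s (locTranslate φ h u) ≤
        ENNReal.ofReal (1 + C * ‖h‖ ^ s) * gagliardoSq s u := by
  obtain ⟨C, hC, H⟩ := exists_eLpNorm_translateBy_sub_le N hs0
  set M : ℝ := (1 + (L : ℝ) ^ 2) *
    ∫ z : EuclideanSpace ℝ (Fin N), fracKernel s z * min 1 (‖z‖ ^ 2) with hM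
  have hM0 : 0 ≤ M := mul_nonneg (by positivity) (integral_nonneg fun z =>
    mul_nonneg (fracKernel_nonneg z) (by positivity))
  refine ⟨1 + 2 * L + 2 * (M * C), by positivity, fun φ u h hφ hu hh hh1 => ?_⟩
  have hr : 0 < ‖h‖ := norm_pos_iff.mpr hh
  -- The commutator costs about `ε⁻¹ |h|^{2s}` and the main term about `ε`; this choice makes both
  -- `|h|^s`.
  set ε := ‖h‖ ^ s with hε
  have hε0 : 0 < ε := Real.rpow_pos_of_pos hr s
  have hε1 : ε ≤ 1 := Real.rpow_le_one hr.le hh1.le hs0.le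
  have hrε : ‖h‖ ≤ ε := by
    simpa using Real.rpow_le_rpow_of_exponent_ge hr hh1.le hs1.le
  have hε2 : ‖h‖ ^ (2 * s) = ε ^ 2 := by
    rw [hε, mul_comm, Real.rpow_mul hr.le, Real.rpow_two]
  have hut : AEMeasurable (translateBy h u) :=
    hu.comp_quasiMeasurePreserving (measurePreserving_add_right volume h).quasiMeasurePreserving
  have hφm : Measurable φ := hφ.lipschitz.continuous.measurable
  have hcm : AEMeasurable fun p : EuclideanSpace ℝ (Fin N) × EuclideanSpace ℝ (Fin N) =>
      ENNReal.ofReal ((1 + ε) * (φ p.1 * gagliardoIntegrand s (translateBy h u) p +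
        (1 - φ p.1) * gagliardoIntegrand s u p)) := by
    refine AEMeasurable.ennreal_ofReal (AEMeasurable.const_mul (AEMeasurable.add ?_ ?_) _)
    · exact AEMeasurable.mul (by fun_prop) (aemeasurable_gagliardoIntegrand hut)
    · exact AEMeasurable.mul (by fun_prop) (aemeasurable_gagliardoIntegrand hu)
  have hpos1 : ∀ p : EuclideanSpace ℝ (Fin N) × EuclideanSpace ℝ (Fin N),
      0 ≤ φ p.1 * gagliardoIntegrand s (translateBy h u) p +
        (1 - φ p.1) * gagliardoIntegrand s u p := fun p =>
    add_nonneg (mul_nonneg (hφ.nonneg _) (gagliardoIntegrand_nonneg _))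
      (mul_nonneg (sub_nonneg.mpr (hφ.le_one _)) (gagliardoIntegrand_nonneg _))
  have hpos2 : ∀ p : EuclideanSpace ℝ (Fin N) × EuclideanSpace ℝ (Fin N),
      0 ≤ fracKernel s (p.1 - p.2) * (φ p.1 - φ p.2) ^ 2 * (translateBy h u - u) p.2 ^ 2 :=
    fun p => mul_nonneg (mul_nonneg (fracKernel_nonneg _) (sq_nonneg _)) (sq_nonneg _)
  have hA : (0 : ℝ) ≤ 1 + ε := by positivity
  have hB : (0 : ℝ) ≤ 1 + ε⁻¹ := by positivity
  have hcomm := lintegral_commutator_le hs0 hs1 hφ (hut.sub hu)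
  rw [← hM] at hcomm
  clear_value M ε
  calc gagliardoSq s (locTranslate φ h u)
      ≤ ∫⁻ p : EuclideanSpace ℝ (Fin N) × EuclideanSpace ℝ (Fin N),
        (ENNReal.ofReal ((1 + ε) * (φ p.1 * gagliardoIntegrand s (translateBy h u) p +
          (1 - φ p.1) * gagliardoIntegrand s u p)) +
        ENNReal.ofReal ((1 + ε⁻¹) * (fracKernel s (p.1 - p.2) * (φ p.1 - φ p.2) ^ 2 *
          (translateBy h u - u) p.2 ^ 2))) := by
        refine lintegral_mono fun p => ?_
        rw [← ENNReal.ofReal_add (mul_nonneg hA (hpos1 p)) (mul_nonneg hB (hpos2 p))]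
        exact ENNReal.ofReal_le_ofReal (gagliardoIntegrand_locTranslate_le hφ hε0 p)
    _ ≤ ENNReal.ofReal (1 + ε) * (ENNReal.ofReal (1 + L * ‖h‖) * gagliardoSq s u) +
        ENNReal.ofReal (1 + ε⁻¹) * (ENNReal.ofReal M * (ENNReal.ofReal (C * ε ^ 2) *
          gagliardoSq s u)) := by
        rw [lintegral_add_left' hcm]
        simp_rw [ENNReal.ofReal_mul hA, ENNReal.ofReal_mul hB]
        rw [lintegral_const_mul' _ _ ENNReal.ofReal_ne_top,
          lintegral_const_mul' _ _ ENNReal.ofReal_ne_top]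
        gcongr
        · exact lintegral_convex_combination_le hφ hu
        · refine hcomm.trans ?_
          rw [← hε2]
          gcongr
          exact H u h hu
    _ = ENNReal.ofReal ((1 + ε) * (1 + L * ‖h‖) + (1 + ε⁻¹) * (M * (C * ε ^ 2))) *
        gagliardoSq s u := by
        rw [ENNReal.ofReal_add (p := (1 + ε) * (1 + L * ‖h‖)) (by positivity) (by positivity),
          ENNReal.ofReal_mul hA,
          ENNReal.ofReal_mul hB, ENNReal.ofReal_mul hM0]
        ring
    _ ≤ _ := by
        refine mul_le_mul' (ENNReal.ofReal_le_ofReal ?_) le_rfl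
        have e1 : (1 + ε⁻¹) * (M * (C * ε ^ 2)) = M * C * (ε ^ 2 + ε) := by
          field_simp
        have e2 : M * C * (ε ^ 2 + ε) ≤ M * C * (2 * ε) := by
          gcongr
          nlinarith
        have e3 : (L : ℝ) * ‖h‖ ≤ L * ε := by gcongr
        have e4 : ε * (L * ‖h‖) ≤ 1 * (L * ε) := by gcongr
        rw [e1]
        linarith

lemma locTranslate_sub (φ : EuclideanSpace ℝ (Fin N) → ℝ) (h : EuclideanSpace ℝ (Fin N))
    (u : EuclideanSpace ℝ (Fin N) → ℝ) :
    locTranslate φ h u - u = fun x => φ x * (translateBy h u - u) x := by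
  ext x
  simp only [locTranslate, Pi.sub_apply]
  ring

lemma eLpNorm_locTranslate_sub_le (hφ : IsCutoff L φ) :
    eLpNorm (locTranslate φ h u - u) 2 volume ≤ eLpNorm (translateBy h u - u) 2 volume := by
  rw [locTranslate_sub]
  refine eLpNorm_mono fun x => ?_
  rw [norm_mul, Real.norm_of_nonneg (hφ.nonneg x)]
  exact mul_le_of_le_one_left (norm_nonneg _) (hφ.le_one x)

/-- Square integrability and vanishing outside `Ω` come from the two summands. Finite energy is left
as a hypothesis, to be supplied by the energy bound for `T_h u`. -/
lemma locTranslate_mem_X0 {Ω : Set (EuclideanSpace ℝ (Fin N))} (hφ : IsCutoff L φ)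
    (hu : u ∈ X0 s Ω) (hmem : (fun x => φ x * translateBy h u x) ∈ X0 s Ω)
    (hfin : gagliardoSq s (locTranslate φ h u) < ∞) : locTranslate φ h u ∈ X0 s Ω := by
  have hφm : Measurable φ := hφ.lipschitz.continuous.measurable
  refine ⟨⟨hmem.1.1.add (hu.1.1.mono ?_ ?_), hfin⟩, ?_⟩
  · exact (AEMeasurable.mul (by fun_prop) hu.1.aemeasurable).aestronglyMeasurable
  · refine Filter.Eventually.of_forall fun x => ?_
    rw [norm_mul, Real.norm_of_nonneg (sub_nonneg.mpr (hφ.le_one x))]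
    exact mul_le_of_le_one_left (norm_nonneg _) (by linarith [hφ.nonneg x])
  · filter_upwards [hu.2, hmem.2] with x h1 h2 hx
    simp only [locTranslate]
    rw [h2 hx, h1 hx]
    simp

end LocTranslate

/-! ### The two estimates -/

theorem mainTheorem1 (N : ℕ) [NeZero N] (s : ℝ) (hs0 : 0 < s) (hs1 : s < 1) (L : ℝ≥0) (d : ℝ) :
    (∃ C : ℝ, 0 < C ∧
      ∀ (Ω : Set (EuclideanSpace ℝ (Fin N))) (f φ u : EuclideanSpace ℝ (Fin N) → ℝ)
        (h : EuclideanSpace ℝ (Fin N)),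
        IsOpen Ω → Bornology.IsBounded Ω → Metric.diam Ω ≤ d →
        MemLp f 2 volume → IsCutoff L φ → ‖h‖ < 1 →
        IsWeakSolution s Ω f u → (fun x => φ x * translateBy h u x) ∈ X0 s Ω →
        eLpNorm (locTranslate φ h u - u) 2 volume ^ 2 ≤ eLpNorm (translateBy h u - u) 2 volume ^ 2 ∧
        eLpNorm (translateBy h u - u) 2 volume ^ 2 ≤
          ENNReal.ofReal (C * ‖h‖ ^ (2 * s)) * dualNormX0 s Ω f ^ 2) ∧
    (∀ ρ θ : ℝ, 0 < ρ → 0 < θ → θ < Real.pi / 2 →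
      ∃ C' : ℝ, 0 < C' ∧
        ∀ (Ω : Set (EuclideanSpace ℝ (Fin N))) (f φ u : EuclideanSpace ℝ (Fin N) → ℝ)
          (h : EuclideanSpace ℝ (Fin N)),
          IsOpen Ω → Bornology.IsBounded Ω → Metric.diam Ω ≤ d →
          MemLp f 2 volume → IsCutoff L φ → ‖h‖ < 1 →
          IsWeakSolution s Ω f u → (fun x => φ x * translateBy h u x) ∈ X0 s Ω →
          LipschitzConeCondition ρ θ Ω → ‖h‖ ≤ ρ * Real.sin θ / 4 →
          gagliardoSq s (locTranslate φ h u - u) ≤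
            ENNReal.ofReal (C' * ‖h‖ ^ s) * eLpNorm f 2 volume * hMinusNorm s f) := by
  obtain ⟨C₁, hC₁, H₁⟩ := exists_eLpNorm_translateBy_sub_le N hs0
  obtain ⟨C₂, hC₂, H₂⟩ := exists_gagliardoSq_le_dualNormX0 N hs0 hs1 d
  obtain ⟨C₃, hC₃, H₃⟩ := exists_gagliardoSq_locTranslate_le N hs0 hs1 L
  have hc : 0 < fracConst N s := fracConst_pos hs0 hs1
  have hL2 : ∀ (Ω : Set (EuclideanSpace ℝ (Fin N))) (f u : EuclideanSpace ℝ (Fin N) → ℝ)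
      (h : EuclideanSpace ℝ (Fin N)), Bornology.IsBounded Ω → Metric.diam Ω ≤ d →
      IsWeakSolution s Ω f u → eLpNorm (translateBy h u - u) 2 volume ^ 2 ≤
        ENNReal.ofReal (C₁ * C₂ * ‖h‖ ^ (2 * s)) * dualNormX0 s Ω f ^ 2 := by
    intro Ω f u h hΩ hd hu
    calc eLpNorm (translateBy h u - u) 2 volume ^ 2
        ≤ ENNReal.ofReal (C₁ * ‖h‖ ^ (2 * s)) * gagliardoSq s u := H₁ u h hu.1.1.aemeasurable
      _ ≤ ENNReal.ofReal (C₁ * ‖h‖ ^ (2 * s)) *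
          (ENNReal.ofReal C₂ * dualNormX0 s Ω f ^ 2) := by
        gcongr
        exact H₂ Ω f u hΩ hd hu
      _ = _ := by
        rw [← mul_assoc, ← ENNReal.ofReal_mul (by positivity)]
        congr 2
        ring
  refine ⟨⟨C₁ * C₂, by positivity, fun Ω f φ u h _ hΩ hd _ hφ _ hu _ => ⟨?_, ?_⟩⟩, ?_⟩
  · gcongr
    exact eLpNorm_locTranslate_sub_le hφ
  · exact hL2 Ω f u h hΩ hd hu
  intro ρ θ _ _ _
  set c := fracConst N s with hcdef
  refine ⟨C₃ * C₂ + 2 / c * √(C₁ * C₂), by positivity,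
    fun Ω f φ u h _ hΩ hd hf hφ hh1 hu hmem _ _ => ?_⟩
  -- The energy bound needs `h ≠ 0`, as its Young weight `|h|^s` is inverted; for `h = 0` the
  -- difference vanishes.
  rcases eq_or_ne h 0 with rfl | hh
  · have : locTranslate φ 0 u - u = 0 := by
      rw [locTranslate_sub]
      ext x
      simp [translateBy]
    rw [this]
    simp [gagliardoSq]
  have hr : 0 < ‖h‖ := norm_pos_iff.mpr hh
  set ε := ‖h‖ ^ s with hε
  have hε0 : 0 < ε := Real.rpow_pos_of_pos hr s
  have hε2 : ‖h‖ ^ (2 * s) = ε ^ 2 := by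
    rw [hε, mul_comm, Real.rpow_mul hr.le, Real.rpow_two]
  have hT := H₃ φ u h hφ hu.1.1.aemeasurable hh hh1
  have hTX : locTranslate φ h u ∈ X0 s Ω := locTranslate_mem_X0 hφ hu.1 hmem
    (hT.trans_lt (ENNReal.mul_lt_top ENNReal.ofReal_lt_top hu.1.1.2))
  set w := locTranslate φ h u - u with hw
  have hwX : w ∈ X0 s Ω := by
    refine ⟨hTX.1.sub hu.1.1, ?_⟩
    filter_upwards [hTX.2, hu.1.2] with x h1 h2 hx
    simp [hw, h1 hx, h2 hx]
  have hpol := hu.1.1.integral_gagliardoIntegrand_add hwX.1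
  rw [hw, add_sub_cancel, ← hw] at hpol
  have htest := hu.2 w hwX
  set B := ∫ p : EuclideanSpace ℝ (Fin N) × EuclideanSpace ℝ (Fin N),
    fracKernel s (p.1 - p.2) * (u p.1 - u p.2) * (w p.1 - w p.2)
  have hu0 : 0 ≤ ∫ p, gagliardoIntegrand s u p := integral_gagliardoIntegrand_nonneg
  rw [← hTX.1.ofReal_integral_gagliardoIntegrand, ← hu.1.1.ofReal_integral_gagliardoIntegrand,
    ← ENNReal.ofReal_mul (by positivity), ENNReal.ofReal_le_ofReal_iff (by positivity)] at hT
  -- The expansion of `‖u + w‖_s²`, with `2 B = (2 / c) ∫ f w` from the weak equation.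
  have hreal : ∫ p, gagliardoIntegrand s w p ≤
      C₃ * ε * (∫ p, gagliardoIntegrand s u p) + 2 / c * |∫ x, f x * w x| := by
    have hB : -(2 * B) ≤ 2 / c * |∫ x, f x * w x| := by
      have : -(2 * B) = 2 / c * -(∫ x, f x * w x) := by
        rw [← htest, ← hcdef]
        field_simp
      rw [this]
      gcongr
      exact neg_le_abs _
    linarith
  have hdual : dualNormX0 s Ω f ≤ hMinusNorm s f := dualNormX0_le_hMinusNorm Ω
  have hdualL2 : dualNormX0 s Ω f ≤ eLpNorm f 2 volume := hdual.trans (hMinusNorm_le_eLpNorm hf)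
  have hwL2 : eLpNorm w 2 volume ≤ ENNReal.ofReal (√(C₁ * C₂) * ε) * hMinusNorm s f := by
    refine (eLpNorm_locTranslate_sub_le hφ).trans (le_trans ?_ (mul_le_mul_right hdual _))
    rw [← ENNReal.pow_le_pow_left_iff two_ne_zero, mul_pow, ← ENNReal.ofReal_pow (by positivity),
      mul_pow, Real.sq_sqrt (by positivity), ← hε2]
    exact hL2 Ω f u h hΩ hd hu
  calc gagliardoSq s w = ENNReal.ofReal (∫ p, gagliardoIntegrand s w p) :=
        hwX.1.ofReal_integral_gagliardoIntegrand.symm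
    _ ≤ ENNReal.ofReal (C₃ * ε) * gagliardoSq s u +
        ENNReal.ofReal (2 / c) * ENNReal.ofReal |∫ x, f x * w x| := by
        rw [← hu.1.1.ofReal_integral_gagliardoIntegrand, ← ENNReal.ofReal_mul (by positivity),
          ← ENNReal.ofReal_mul (by positivity), ← ENNReal.ofReal_add (by positivity)
            (by positivity)]
        exact ENNReal.ofReal_le_ofReal hreal
    _ ≤ ENNReal.ofReal (C₃ * ε) *
          (ENNReal.ofReal C₂ * (eLpNorm f 2 volume * hMinusNorm s f)) +
        ENNReal.ofReal (2 / c) * (eLpNorm f 2 volume *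
          (ENNReal.ofReal (√(C₁ * C₂) * ε) * hMinusNorm s f)) := by
        gcongr
        -- Of the two dual-norm factors, one is raised to `‖f‖_{L²}` and the other to
        -- `‖f‖_{H^{-s}}`, matching the second term.
        · refine (H₂ Ω f u hΩ hd hu).trans ?_
          rw [sq]
          gcongr
        · refine (ofReal_abs_integral_mul_le hf hwX.1.1).trans ?_
          gcongr
    _ = _ := by
        rw [show (C₃ * C₂ + 2 / c * √(C₁ * C₂)) * ε =
          C₃ * ε * C₂ + 2 / c * (√(C₁ * C₂) * ε) by ring,
          ENNReal.ofReal_add (by positivity) (by positivity),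
          ENNReal.ofReal_mul (p := C₃ * ε) (by positivity),
          ENNReal.ofReal_mul (p := 2 / c) (by positivity)]
        ring
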